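/- Let $M=(Q,r)$ be a matroid on a finite ground set $Q$. Call $M$ algebraic if there are a field $\mathbb F$, a field extension $\mathbb K/\mathbb F$ and elements $(e_i)_{i\in Q}$ of $\mathbb K$ such that for every $S\subseteq Q$ the rank $r(S)$ equals the transcendence degree over $\mathbb F$ of the field $\mathbb F((e_i)_{i\in S})$. Suppose that $M$ is algebraic, let $X,Y,Z\subseteq Q$ be flats of $M$, and put $A=X\cap Y\cap Z$. Assume that 1. in the lattice of flats of $M$, $X$ covers $X\cap Z$ and $Y$ covers $Y\cap Z$ (where a flat $G$ covers a flat $F$ if $F\subsetneq G$ and no flat $H$ satisfies $F\subsetneq H\subsetneq G$); and 2. $r(X\cap Y)-r(A)>1$. Then there exists an algebraic matroid $M'=(Q\cup\{e\},r')$, where $e\notin Q$, such that $r'(S)=r(S)$ for every $S\subseteq Q$, the point $e$ lies in the closure in $M'$ of each of $X$, $Y$ and $Z$, and $r'(A\cup\{e\})>r'(A)$. -/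

import Mathlib

universe u v w

/-- `M` is algebraically representable over the field `F`: there are a field extension `K` of `F`
and elements `e i` of `K`, for `i` in the ground set, such that the rank of every `A ⊆ M.E` is the
transcendence degree over `F` of the subfield of `K` generated by `F` and the `e i`, `i ∈ A`.
(The values of `e` outside the ground set play no role.) -/
def IsAlgebraicallyRepresentable {α : Type w} (M : Matroid α) (F : Type u) [Field F] : Prop :=
  ∃ (K : Type v) (_ : Field K) (_ : Algebra F K) (e : α → K), ∀ A ⊆ M.E,
    M.eRk A = Cardinal.toENat (Algebra.trdeg F (IntermediateField.adjoin F (e '' A)))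

/-- `M` is algebraic: it is algebraically representable over some field. -/
def IsAlgebraicMatroid {α : Type w} (M : Matroid α) : Prop :=
  ∃ (F : Type u) (_ : Field F), IsAlgebraicallyRepresentable.{u, v, w} M F

/-- `G` covers `F` in the lattice of flats of `M`. -/
def FlatCovers {α : Type w} (M : Matroid α) (G F : Set α) : Prop :=
  M.IsFlat F ∧ M.IsFlat G ∧ F ⊂ G ∧ ∀ H, M.IsFlat H → F ⊂ H → ¬ H ⊂ G

/-- `M'` is an extension of `M` by a single new point. The ground set of `M'` is a copy of that of
`M` (embedded by `some`) together with the new point `none`, and the rank functions agree on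
the subsets of the ground set of `M`. -/
def IsPointExtension {α : Type w} (M' : Matroid (Option α)) (M : Matroid α) : Prop :=
  M'.E = insert none (some '' M.E) ∧ ∀ S ⊆ M.E, M'.eRk (some '' S) = M.eRk S

/-!
The idea is that of the Ingleton–Main lemma. Represent `M` in an algebraically closed field `K`, so
that closures are algebraically closed subfields of `K`. Since `X ∩ Y` has rank at least two more
than `A`, it contains points `u` and `v` that are independent over `A`. As `X` covers `X ∩ Z` and
`u ∉ Z`, the flat `X` is spanned by `X ∩ Z` and `u`, so `u` and `v` satisfy an irreducible equation
with coefficients in the closure of `X ∩ Z`; likewise they satisfy one with coefficients in the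
closure of `Y ∩ Z`. Both coefficient fields are algebraically closed, so the two equations stay
irreducible over the closure of `Z` (`Polynomial.irreducible_map_mapRingHom_of_isAlgClosed`). Since
`u` is transcendental over that field, Gauss's lemma makes both of them the minimal equation of `v`
(`Polynomial.associated_of_irreducible_of_aeval_eq_zero`). After normalization they coincide, and
their coefficients lie in the closures of both `X ∩ Z` and `Y ∩ Z`. The coefficients cannot all lie
in the closure of `A`, because `u` and `v` are independent over `A`; one that does not is the new
point (`exists_mem_closureField_inter`).
-/

open Polynomial

/-! ### Bivariate polynomials over algebraically closed fields -/

/-- A form of the Nullstellensatz: over an algebraically closed field, a finitely generated domain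
has a rational point outside the zero locus of any given nonzero element. -/
theorem exists_algHom_apply_ne_zero_of_isAlgClosed {k B : Type*} [Field k] [IsAlgClosed k]
    [CommRing B] [IsDomain B] [Algebra k B] [Algebra.FiniteType k B] {f : B} (hf : f ≠ 0) :
    ∃ φ : B →ₐ[k] k, φ f ≠ 0 := by
  let S := Localization.Away f
  have : Nontrivial S := (IsLocalization.injective S
    (powers_le_nonZeroDivisors_of_noZeroDivisors hf)).nontrivial
  have : Algebra.FiniteType B S := IsLocalization.finiteType_of_monoid_fg (Submonoid.powers f) S
  have : Algebra.FiniteType k S := Algebra.FiniteType.trans (S := B) inferInstance inferInstance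
  obtain ⟨m, hm⟩ := Ideal.exists_maximal S
  let : Field (S ⧸ m) := Ideal.Quotient.field m
  have : Module.Finite k (S ⧸ m) := finite_of_finite_type_of_isJacobsonRing k (S ⧸ m)
  let e : k ≃ₐ[k] (S ⧸ m) := AlgEquiv.ofBijective (Algebra.ofId k (S ⧸ m))
    IsAlgClosed.algebraMap_bijective_of_isIntegral
  refine ⟨(e.symm.toAlgHom.comp (Ideal.Quotient.mkₐ k m)).comp (IsScalarTower.toAlgHom k B S), ?_⟩
  have hu : IsUnit (algebraMap B S f) := IsLocalization.Away.algebraMap_isUnit f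
  exact (hu.map (e.symm.toAlgHom.comp (Ideal.Quotient.mkₐ k m))).ne_zero

theorem Polynomial.isUnit_iff_bivariate {k : Type*} [Field k] {p : k[X][X]} :
    IsUnit p ↔ ∃ a : k, a ≠ 0 ∧ C (C a) = p := by
  simp only [Polynomial.isUnit_iff]
  constructor
  · rintro ⟨_, ⟨a, ha, rfl⟩, rfl⟩
    exact ⟨a, ha.ne_zero, rfl⟩
  · rintro ⟨a, ha, rfl⟩
    exact ⟨_, ⟨a, ha.isUnit, rfl⟩, rfl⟩

theorem Polynomial.exists_coeff_coeff_ne_zero_of_not_isUnit {k : Type*} [Field k] {p : k[X][X]}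
    (hp : p ≠ 0) (hu : ¬ IsUnit p) : ∃ i j, (i ≠ 0 ∨ j ≠ 0) ∧ (p.coeff j).coeff i ≠ 0 := by
  by_contra! h
  have hpc : p = C (C ((p.coeff 0).coeff 0)) := by
    ext j i
    by_cases hj : j = 0 <;> by_cases hi : i = 0
    · simp [hj, hi]
    · rw [h i j (.inl hi)]; simp [hj, coeff_C, hi]
    · rw [h i j (.inr hj)]; simp [coeff_C, hj]
    · rw [h i j (.inr hj)]; simp [coeff_C, hj]
  refine hu (isUnit_iff_bivariate.2 ⟨_, fun h0 ↦ hp ?_, hpc.symm⟩)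
  rw [hpc, h0]; simp

theorem Polynomial.not_isUnit_of_coeff_coeff_ne_zero {k : Type*} [Field k] {p : k[X][X]} {i j : ℕ}
    (hij : i ≠ 0 ∨ j ≠ 0) (h : (p.coeff j).coeff i ≠ 0) : ¬ IsUnit p := by
  rintro hu
  obtain ⟨a, -, rfl⟩ := isUnit_iff_bivariate.1 hu
  rcases hij with hi | hj
  · by_cases hj : j = 0 <;> simp [coeff_C, hi, hj] at h
  · simp [coeff_C, hj] at h

theorem Polynomial.exists_map_mapRingHom_eq {R L : Type*} [Ring R] [Ring L] (f : R →+* L)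
    (p : L[X][X]) (h : ∀ i j, (p.coeff j).coeff i ∈ f.range) :
    ∃ q : R[X][X], q.map (mapRingHom f) = p := by
  refine (mem_lifts _).1 ((lifts_iff_coeff_lifts _).2 fun j ↦ ?_)
  obtain ⟨q, hq⟩ := (mem_lifts _).1 ((lifts_iff_coeff_lifts (f := f) (p.coeff j)).2 fun i ↦ h i j)
  exact ⟨q, hq⟩

/-- An irreducible bivariate polynomial over an algebraically closed field stays irreducible over
every larger field. A factorization over the larger field has its coefficients in a finitely
generated algebra over the small one, and a specialization of that algebra that keeps one
nonconstant coefficient of each factor turns it into a nontrivial factorization over the small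
field. -/
theorem Polynomial.irreducible_map_mapRingHom_of_isAlgClosed {k L : Type*} [Field k]
    [IsAlgClosed k] [Field L] (f : k →+* L) {p : k[X][X]} (hp : Irreducible p) :
    Irreducible (p.map (mapRingHom f)) := by
  classical
  have hinj : Function.Injective (mapRingHom f) := by
    simpa using map_injective f f.injective
  refine ⟨fun hu ↦ ?_, fun G H hGH ↦ ?_⟩
  · obtain ⟨i, j, hij, hc⟩ := exists_coeff_coeff_ne_zero_of_not_isUnit hp.ne_zero hp.not_isUnit
    exact not_isUnit_of_coeff_coeff_ne_zero hij (by simpa using hc) hu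
  by_contra! hu
  have hGH0 : G * H ≠ 0 := by
    rw [← hGH]; exact (Polynomial.map_ne_zero_iff hinj).2 hp.ne_zero
  obtain ⟨i, j, hij, hc⟩ := exists_coeff_coeff_ne_zero_of_not_isUnit (left_ne_zero_of_mul hGH0) hu.1
  obtain ⟨i', j', hij', hc'⟩ :=
    exists_coeff_coeff_ne_zero_of_not_isUnit (right_ne_zero_of_mul hGH0) hu.2
  algebraize [f]
  let s : Set L := (G.coeffs.biUnion coeffs ∪ H.coeffs.biUnion coeffs : Finset L)
  let R := Algebra.adjoin k s
  have : Algebra.FiniteType k R :=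
    (Subalgebra.fg_iff_finiteType _).1 (Subalgebra.fg_adjoin_finset _)
  have hcoeff (P : L[X][X]) (hP : (P.coeffs.biUnion coeffs : Set L) ⊆ s) (i j : ℕ) :
      (P.coeff j).coeff i ∈ (algebraMap R L).range := by
    by_cases h : (P.coeff j).coeff i = 0
    · rw [h]; exact zero_mem _
    · refine ⟨⟨_, Algebra.subset_adjoin (hP ?_)⟩, rfl⟩
      simp only [Finset.coe_biUnion, Finset.mem_coe, Set.mem_iUnion]
      exact ⟨P.coeff j, coeff_mem_coeffs (fun h' ↦ h (by simp [h'])), coeff_mem_coeffs h⟩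
  obtain ⟨G', hG⟩ := exists_map_mapRingHom_eq (algebraMap R L) G (hcoeff G (by simp [s]))
  obtain ⟨H', hH⟩ := exists_map_mapRingHom_eq (algebraMap R L) H (hcoeff H (by simp [s]))
  have hR : Function.Injective (algebraMap R L) := Subtype.val_injective
  have hGH' : p.map (mapRingHom (algebraMap k R)) = G' * H' := by
    apply map_injective (mapRingHom (algebraMap R L)) (by simpa using map_injective _ hR)
    rw [Polynomial.map_mul, hG, hH, ← hGH, Polynomial.map_map, mapRingHom_comp]
    rfl
  simp only [← hG, ← hH, coeff_map, coe_mapRingHom, ne_eq, map_eq_zero_iff _ hR] at hc hc'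
  -- The coefficients at `(i, j)` and `(i', j')` survive under `φ`, so neither factor becomes a
  -- unit.
  obtain ⟨φ, hφ⟩ := exists_algHom_apply_ne_zero_of_isAlgClosed (k := k) (mul_ne_zero hc hc')
  rw [map_mul] at hφ
  have hpGH : p = G'.map (mapRingHom φ.toRingHom) * H'.map (mapRingHom φ.toRingHom) := by
    rw [← Polynomial.map_mul, ← hGH', Polynomial.map_map, mapRingHom_comp]
    simp
  rcases hp.isUnit_or_isUnit hpGH with h | h
  · exact not_isUnit_of_coeff_coeff_ne_zero hij (by simpa using left_ne_zero_of_mul hφ) h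
  · exact not_isUnit_of_coeff_coeff_ne_zero hij' (by simpa using right_ne_zero_of_mul hφ) h

/-- Two irreducible polynomials over `R` with a common root `v` in a field containing `R` are
associated: by Gauss's lemma both are, up to a unit, the minimal polynomial of `v` over the fraction
field of `R`. -/
theorem Polynomial.associated_of_irreducible_of_aeval_eq_zero {R K : Type*} [CommRing R]
    [IsDomain R] [NormalizedGCDMonoid R] [Field K] [Algebra R K] [FaithfulSMul R K] {v : K}
    {p q : R[X]} (hp : Irreducible p) (hq : Irreducible q)
    (hpv : aeval v p = 0) (hqv : aeval v q = 0) : Associated p q := by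
  let F := FractionRing R
  let : Algebra F K := FractionRing.liftAlgebra R K
  have : IsScalarTower R F K := FractionRing.isScalarTower_liftAlgebra R K
  have key (p : R[X]) (hp : Irreducible p) (hpv : aeval v p = 0) : p.IsPrimitive ∧
      Associated (p.map (algebraMap R F)) (minpoly F v) := by
    have hp' : p.IsPrimitive := by
      refine hp.isPrimitive fun h0 ↦ hp.ne_zero ?_
      rw [eq_C_of_natDegree_eq_zero h0, aeval_C,
        map_eq_zero_iff _ (FaithfulSMul.algebraMap_injective R K)] at hpv
      rw [eq_C_of_natDegree_eq_zero h0, hpv, C_0]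
    have hirr := hp'.irreducible_iff_irreducible_map_fraction_map (K := F) |>.1 hp
    refine ⟨hp', ?_⟩
    rw [← minpoly.eq_of_irreducible hirr (x := v) (by simpa using hpv)]
    refine (associated_mul_unit_right _ _ ?_)
    simpa [isUnit_C] using hirr.ne_zero
  obtain ⟨hp1, hp2⟩ := key p hp hpv
  obtain ⟨hq1, hq2⟩ := key q hq hqv
  have h := hp2.trans hq2.symm
  exact associated_of_dvd_dvd
    (hp1.dvd_of_fraction_map_dvd_fraction_map h.dvd)
    (hq1.dvd_of_fraction_map_dvd_fraction_map h.dvd')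

theorem Polynomial.exists_irreducible_eval₂_eq_zero {R K : Type*} [CommRing R] [IsDomain R]
    [UniqueFactorizationMonoid R] [Field K] (φ : R →+* K) {v : K} {p : R[X]} (hp : p ≠ 0)
    (hv : p.eval₂ φ v = 0) : ∃ q : R[X], Irreducible q ∧ q.eval₂ φ v = 0 := by
  let I := RingHom.ker (eval₂RingHom φ v)
  have : I.IsPrime := RingHom.ker_isPrime _
  obtain ⟨q, hqI, hq⟩ := this.exists_mem_prime_of_ne_bot
    (fun h ↦ hp ((Submodule.mem_bot _).1 (h ▸ (show p ∈ I from hv))))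
  exact ⟨q, hq.irreducible, hqI⟩

theorem Polynomial.eval₂RingHom_comp_mapRingHom {R S T : Type*} [CommSemiring R] [CommSemiring S]
    [CommSemiring T] (i : R →+* S) (j : S →+* T) (u : T) :
    (eval₂RingHom j u).comp (mapRingHom i) = eval₂RingHom (j.comp i) u := by
  ext <;> simp

/-- Let `k₁` and `k₂` be algebraically closed subfields of `L`, and let `u` be transcendental over
`L`. If `(u, v)` is a zero of a nonzero bivariate polynomial over `k₁` and of one over `k₂`, then it
is a zero of one with coefficients in `k₁ ∩ k₂`. The inner variable is evaluated at `u`, the outer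
one at `v`; the transcendence of `u` is expressed as injectivity of evaluation at `u`. -/
theorem Polynomial.exists_coeff_mem_range_of_isAlgClosed {k₁ k₂ L K : Type*} [Field k₁] [Field k₂]
    [IsAlgClosed k₁] [IsAlgClosed k₂] [Field L] [Field K] (i₁ : k₁ →+* L) (i₂ : k₂ →+* L)
    (j : L →+* K) {u v : K} (hu : Function.Injective (eval₂RingHom j u))
    {p₁ : k₁[X][X]} (hp₁ : p₁ ≠ 0) (h₁ : p₁.eval₂ (eval₂RingHom (j.comp i₁) u) v = 0)
    {p₂ : k₂[X][X]} (hp₂ : p₂ ≠ 0) (h₂ : p₂.eval₂ (eval₂RingHom (j.comp i₂) u) v = 0) :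
    ∃ p : L[X][X], p ≠ 0 ∧ p.eval₂ (eval₂RingHom j u) v = 0 ∧
      ∀ a b, (p.coeff b).coeff a ∈ i₁.range ∧ (p.coeff b).coeff a ∈ i₂.range := by
  classical
  obtain ⟨q₁, hq₁, hv₁⟩ := exists_irreducible_eval₂_eq_zero _ hp₁ h₁
  obtain ⟨q₂, hq₂, hv₂⟩ := exists_irreducible_eval₂_eq_zero _ hp₂ h₂
  have hr₁ : (q₁.map (mapRingHom i₁)).eval₂ (eval₂RingHom j u) v = 0 := by
    rw [eval₂_map, eval₂RingHom_comp_mapRingHom, hv₁]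
  have hr₂ : (q₂.map (mapRingHom i₂)).eval₂ (eval₂RingHom j u) v = 0 := by
    rw [eval₂_map, eval₂RingHom_comp_mapRingHom, hv₂]
  algebraize [eval₂RingHom j u]
  have : FaithfulSMul L[X] K := (faithfulSMul_iff_algebraMap_injective _ _).2 hu
  obtain ⟨w, hw⟩ := associated_of_irreducible_of_aeval_eq_zero (K := K) (v := v)
    (irreducible_map_mapRingHom_of_isAlgClosed i₁ hq₁)
    (irreducible_map_mapRingHom_of_isAlgClosed i₂ hq₂) hr₁ hr₂
  obtain ⟨c, hc, hcw⟩ := isUnit_iff_bivariate.1 w.isUnit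
  have hcoeff (a b : ℕ) : i₁ ((q₁.coeff b).coeff a) * c = i₂ ((q₂.coeff b).coeff a) := by
    have := congr((($hw).coeff b).coeff a)
    simpa [← hcw] using this
  -- The two irreducible equations differ by a constant `c`, so they agree once both are scaled to
  -- have coefficient `1` at a monomial that occurs in them.
  obtain ⟨a, b, -, hab⟩ := exists_coeff_coeff_ne_zero_of_not_isUnit hq₁.ne_zero hq₁.not_isUnit
  set d := (q₁.coeff b).coeff a with hd
  have hd0 : i₁ d ≠ 0 := (_root_.map_ne_zero i₁).2 hab
  refine ⟨q₁.map (mapRingHom i₁) * C (C (i₁ d)⁻¹), ?_, ?_, fun a' b' ↦ ?_⟩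
  · refine mul_ne_zero (irreducible_map_mapRingHom_of_isAlgClosed i₁ hq₁).ne_zero ?_
    simpa using hab
  · rw [eval₂_mul, hr₁, zero_mul]
  · simp only [coeff_mul_C, coeff_map, coe_mapRingHom]
    refine ⟨⟨(q₁.coeff b').coeff a' * d⁻¹, by simp⟩,
      ⟨(q₂.coeff b').coeff a' * ((q₂.coeff b).coeff a)⁻¹, ?_⟩⟩
    rw [map_mul, map_inv₀, ← hcoeff, ← hcoeff, ← hd]
    field_simp

/-! ### The matroid of algebraic independence -/

section FullAlgebraicMatroid

variable {F : Type*} {K : Type*} [Field F] [Field K] [Algebra F K]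

/-- The elements of `K` that are algebraic over the subfield generated by `F` and `s`. As a set this
is the closure of `s` in `AlgebraicIndependent.matroid F K`; as an intermediate field it provides
the field structure. -/
def closureField (F : Type*) {K : Type*} [Field F] [Field K] [Algebra F K] (s : Set K) :
    IntermediateField F K :=
  (algebraicClosure (IntermediateField.adjoin F s) K).restrictScalars F

theorem mem_closureField_iff_isAlgebraic {s : Set K} {x : K} :
    x ∈ closureField F s ↔ IsAlgebraic (Algebra.adjoin F s) x := by
  rw [closureField, IntermediateField.mem_restrictScalars, mem_algebraicClosure_iff,
    IntermediateField.isAlgebraic_adjoin_iff]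

theorem mem_matroid_closure_iff_mem_closureField {s : Set K} {x : K} :
    x ∈ (AlgebraicIndependent.matroid F K).closure s ↔ x ∈ closureField F s := by
  rw [AlgebraicIndependent.matroid_closure_eq, mem_closureField_iff_isAlgebraic]
  rfl

theorem isAlgClosed_closureField [IsAlgClosed K] (s : Set K) : IsAlgClosed (closureField F s) :=
  IsAlgClosure.isAlgClosed (R := IntermediateField.adjoin F s)
    (K := algebraicClosure (IntermediateField.adjoin F s) K)

theorem subset_closureField (s : Set K) : s ⊆ closureField F s := fun _ hx ↦
  mem_closureField_iff_isAlgebraic.2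
    (isAlgebraic_algebraMap (⟨_, Algebra.subset_adjoin hx⟩ : Algebra.adjoin F s))

theorem transcendental_closureField {s : Set K} {u : K} (hu : u ∉ closureField F s) :
    Transcendental (closureField F s) u := by
  have : Transcendental (IntermediateField.adjoin F s) u := by
    rwa [IntermediateField.transcendental_adjoin_iff, Transcendental,
      ← mem_closureField_iff_isAlgebraic]
  exact this.algebraicClosure

theorem closureField_mono {s t : Set K} (h : s ⊆ closureField F t) :
    closureField F s ≤ closureField F t := by
  intro x
  simp only [← mem_matroid_closure_iff_mem_closureField]
  have hst : s ⊆ (AlgebraicIndependent.matroid F K).closure t :=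
    fun y hy ↦ mem_matroid_closure_iff_mem_closureField.2 (h hy)
  have hcl := Matroid.closure_subset_closure_of_subset_closure hst
  exact fun hx ↦ hcl hx

/-- If `v` lies in the closure of `insert u s`, then `(u, v)` is a zero of a nonzero bivariate
polynomial over the closure of `s`. -/
theorem exists_bivariate_of_mem_closureField_insert {s : Set K} {u v : K}
    (hv : v ∈ closureField F (insert u s)) :
    ∃ p : (closureField F s)[X][X], p ≠ 0 ∧
      p.eval₂ (eval₂RingHom (algebraMap (closureField F s) K) u) v = 0 := by
  obtain ⟨q, hq0, hqv⟩ := mem_closureField_iff_isAlgebraic.1 hv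
  let φ : (closureField F s)[X] →ₐ[F] K := (aeval u).restrictScalars F
  have hle : Algebra.adjoin F (insert u s) ≤ φ.range := by
    refine Algebra.adjoin_le (Set.insert_subset ⟨X, by simp [φ]⟩ fun x hx ↦ ?_)
    exact ⟨C ⟨x, subset_closureField s hx⟩, by simp [φ]⟩
  obtain ⟨p, hp⟩ := (mem_lifts (f := φ.toRingHom) _).1
    ((lifts_iff_coeff_lifts (q.map (algebraMap _ K))).2 fun n ↦ by
      rw [coeff_map]; exact hle (q.coeff n).2)
  refine ⟨p, ?_, ?_⟩
  · rintro rfl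
    rw [Polynomial.map_zero] at hp
    exact hq0 (map_injective (algebraMap (Algebra.adjoin F (insert u s)) K)
      Subtype.val_injective (by rw [← hp, Polynomial.map_zero]))
  · have : p.eval₂ φ.toRingHom v = 0 := by
      rw [← eval_map, hp, eval_map]; exact hqv
    exact this

/-- If `u` is transcendental over `L`, and `(u, v)` is a zero of a nonzero bivariate polynomial over
`L` whose coefficients lie in the closure of `s`, then `v` lies in the closure of `insert u s`. -/
theorem mem_closureField_insert_of_bivariate {L : Type*} [Field L] (j : L →+* K) {s : Set K}
    {u v : K} (hu : Function.Injective (eval₂RingHom j u)) {p : L[X][X]} (hp : p ≠ 0)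
    (hpv : p.eval₂ (eval₂RingHom j u) v = 0)
    (hps : ∀ a b, j ((p.coeff b).coeff a) ∈ closureField F s) :
    v ∈ closureField F (insert u s) := by
  by_contra hv
  have hmono : closureField F s ≤ closureField F (insert u s) :=
    closureField_mono ((Set.subset_insert u s).trans (subset_closureField _))
  -- Substituting `u` for the inner variable gives a polynomial over the closure of `insert u s`.
  obtain ⟨q, hq⟩ := (mem_lifts (f := algebraMap (closureField F (insert u s)) K) _).1
    ((lifts_iff_coeff_lifts (p.map (eval₂RingHom j u))).2 fun b ↦ by
      refine ⟨⟨eval₂RingHom j u (p.coeff b), ?_⟩, by rw [coeff_map]; rfl⟩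
      rw [coe_eval₂RingHom, eval₂_eq_sum_range]
      exact sum_mem fun a _ ↦ mul_mem (hmono (hps a b))
        (pow_mem (subset_closureField _ (Set.mem_insert u s)) a))
  refine transcendental_closureField hv ⟨q, ?_, ?_⟩
  · rintro rfl
    rw [Polynomial.map_zero, eq_comm, Polynomial.map_eq_zero_iff hu] at hq
    exact hp hq
  · rw [aeval_def, ← eval_map, hq, eval_map, hpv]

theorem IntermediateField.exists_ringHom_comp_eq_of_le {S T : IntermediateField F K} (h : S ≤ T) :
    ∃ i : S →+* T, (algebraMap T K).comp i = algebraMap S K :=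
  ⟨(IntermediateField.inclusion h).toRingHom, rfl⟩

/-- If `u` is not in the closure of `z ⊇ x ∪ y`, and `v` is in the closures of `insert u x` and
`insert u y` but not in that of `insert u a`, then the closures of `x` and `y` share an element
outside the closure of `a`: a coefficient of the normalized equation between `u` and `v`. -/
theorem exists_mem_closureField_inter [IsAlgClosed K] {x y z a : Set K} {u v : K}
    (hx : x ⊆ z) (hy : y ⊆ z) (hu : u ∉ closureField F z)
    (hvx : v ∈ closureField F (insert u x)) (hvy : v ∈ closureField F (insert u y))
    (hva : v ∉ closureField F (insert u a)) :
    ∃ e, e ∈ closureField F x ∧ e ∈ closureField F y ∧ e ∉ closureField F a := by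
  have := isAlgClosed_closureField (F := F) x
  have := isAlgClosed_closureField (F := F) y
  obtain ⟨i₁, hi₁⟩ := IntermediateField.exists_ringHom_comp_eq_of_le
    (closureField_mono (F := F) (hx.trans (subset_closureField z)))
  obtain ⟨i₂, hi₂⟩ := IntermediateField.exists_ringHom_comp_eq_of_le
    (closureField_mono (F := F) (hy.trans (subset_closureField z)))
  obtain ⟨p₁, hp₁, h₁⟩ := exists_bivariate_of_mem_closureField_insert hvx
  obtain ⟨p₂, hp₂, h₂⟩ := exists_bivariate_of_mem_closureField_insert hvy
  rw [← hi₁] at h₁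
  rw [← hi₂] at h₂
  have hinj : Function.Injective (eval₂RingHom (algebraMap (closureField F z) K) u) :=
    transcendental_iff_injective.1 (transcendental_closureField hu)
  obtain ⟨p, hp, hpv, hcoeff⟩ :=
    exists_coeff_mem_range_of_isAlgClosed i₁ i₂ _ hinj hp₁ h₁ hp₂ h₂
  by_contra! h
  refine hva (mem_closureField_insert_of_bivariate _ hinj hp hpv fun i j ↦ ?_)
  obtain ⟨⟨c, hc⟩, ⟨d, hd⟩⟩ := hcoeff i j
  refine h _ ?_ ?_
  · rw [← hc, ← RingHom.comp_apply, hi₁]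
    exact c.2
  · rw [← hd, ← RingHom.comp_apply, hi₂]
    exact d.2

/-- Algebraic independence over `F` does not change under an extension of the ambient field. -/
theorem matroid_comap_eq {E : Type*} [Field E] [Algebra F E] (f : E →ₐ[F] K) :
    (AlgebraicIndependent.matroid F K).comap f = AlgebraicIndependent.matroid F E := by
  refine Matroid.ext_indep (by simp) fun I _ ↦ ?_
  rw [Matroid.comap_indep_iff, AlgebraicIndependent.matroid_indep_iff,
    AlgebraicIndependent.matroid_indep_iff,
    and_iff_left (show Function.Injective f from f.injective).injOn]
  rw [AlgebraicIndepOn, AlgebraicIndepOn,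
    ← f.algebraicIndependent_iff f.injective,
    ← algebraicIndependent_equiv (Equiv.Set.image f I f.injective)]
  rfl

/-- The rank of `s` in the matroid of algebraic independence is the transcendence degree over `F` of
the subfield generated by `F` and `s`; both sides are `⊤` when that degree is infinite. -/
theorem matroid_eRk_eq_toENat_trdeg (s : Set K) :
    (AlgebraicIndependent.matroid F K).eRk s =
      Cardinal.toENat (Algebra.trdeg F (IntermediateField.adjoin F s)) := by
  let E := IntermediateField.adjoin F s
  have hE : (E : Set K) ⊆ (AlgebraicIndependent.matroid F K).closure s := by
    have : E ≤ closureField F s := IntermediateField.adjoin_le_iff.2 (subset_closureField s)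
    exact fun x hx ↦ mem_matroid_closure_iff_mem_closureField.2 (this hx)
  have hsE : (AlgebraicIndependent.matroid F K).eRk s =
      (AlgebraicIndependent.matroid F K).eRk E := by
    refine le_antisymm (Matroid.eRk_mono _ (IntermediateField.subset_adjoin F s)) ?_
    rw [← Matroid.eRk_closure_eq _ s]
    exact Matroid.eRk_mono _ hE
  rw [← AlgebraicIndependent.matroid_cRank_eq, Matroid.toENat_cRank_eq, Matroid.eRank_def,
    ← matroid_comap_eq E.val, Matroid.eRk_comap, hsE]
  simp [E]

end FullAlgebraicMatroid

/-! ### Algebraic point extensions -/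

theorem Matroid.mem_closure_iff_eRk_insert_eq {α : Type*} {M : Matroid α} {S : Set α} {q : α}
    (hq : q ∈ M.E) (hS : M.IsRkFinite S) :
    q ∈ M.closure S ↔ M.eRk (insert q S) = M.eRk S := by
  refine ⟨fun h ↦ ?_, fun h ↦ ?_⟩
  · rw [← Matroid.eRk_insert_closure_eq, Set.insert_eq_of_mem h, Matroid.eRk_closure_eq]
  · by_contra hn
    rw [Matroid.eRk_insert_eq_add_one ⟨hq, hn⟩] at h
    exact (ENat.lt_add_one_iff hS.eRk_lt_top.ne).2 le_rfl |>.ne' h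

theorem Matroid.eRk_comapOn {α β : Type*} (N : Matroid β) (f : α → β) {E S : Set α} (hS : S ⊆ E) :
    (N.comapOn E f).eRk S = N.eRk (f '' S) := by
  rw [Matroid.comapOn, Matroid.restrict_eRk_eq _ hS, Matroid.eRk_comap]

/-- A map that preserves ranks preserves and reflects membership in the closure of a finite set. -/
theorem Matroid.mem_closure_iff_of_eRk_eq {α β : Type*} {M : Matroid α} {N : Matroid β}
    (e : α → β) (h : ∀ S ⊆ M.E, M.eRk S = N.eRk (e '' S)) {S : Set α} {q : α} (hS : S ⊆ M.E)
    (hSfin : S.Finite) (hq : q ∈ M.E) (heq : e q ∈ N.E) :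
    q ∈ M.closure S ↔ e q ∈ N.closure (e '' S) := by
  rw [mem_closure_iff_eRk_insert_eq hq (M.isRkFinite_of_finite hSfin),
    mem_closure_iff_eRk_insert_eq heq (N.isRkFinite_of_finite (hSfin.image e)), h S hS,
    h _ (Set.insert_subset hq hS), Set.image_insert_eq]

theorem FlatCovers.closure_insert_eq {α : Type*} {M : Matroid α} {G H : Set α} {u : α}
    (h : FlatCovers M G H) (hu : u ∈ G) (huH : u ∉ H) : M.closure (insert u H) = G := by
  obtain ⟨-, hG, hHG, hcov⟩ := h
  have hsub : insert u H ⊆ G := Set.insert_subset hu hHG.subset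
  have hle : M.closure (insert u H) ⊆ G := hG.closure ▸ M.closure_subset_closure hsub
  have hge : insert u H ⊆ M.closure (insert u H) :=
    M.subset_closure _ (hsub.trans hG.subset_ground)
  by_contra hne
  refine hcov _ (M.isFlat_closure _) ⟨(Set.subset_insert u H).trans hge, fun h' ↦ ?_⟩
    (hle.ssubset_of_ne hne)
  exact huH (h' (hge (Set.mem_insert u H)))

/-- Every algebraic matroid is represented in an algebraically closed field, in the same universe as
the given representation. -/
theorem IsAlgebraicMatroid.exists_isAlgClosed {α : Type w} {M : Matroid α}
    (hM : IsAlgebraicMatroid.{u, v, w} M) :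
    ∃ (F : Type u) (_ : Field F) (K : Type v) (_ : Field K) (_ : IsAlgClosed K) (_ : Algebra F K)
      (e : α → K), ∀ S ⊆ M.E, M.eRk S = (AlgebraicIndependent.matroid F K).eRk (e '' S) := by
  obtain ⟨F, _, K, _, _, e, he⟩ := hM
  refine ⟨F, inferInstance, AlgebraicClosure K, inferInstance, inferInstance, inferInstance,
    fun i ↦ algebraMap K (AlgebraicClosure K) (e i), fun S hS ↦ ?_⟩
  rw [he S hS, ← matroid_eRk_eq_toENat_trdeg,
    ← matroid_comap_eq (IsScalarTower.toAlgHom F K (AlgebraicClosure K)), Matroid.eRk_comap,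
    Set.image_image]
  rfl

theorem isAlgebraicMatroid_comapOn {α : Type w} {F : Type u} {K : Type v} [Field F] [Field K]
    [Algebra F K] (E : Set α) (e : α → K) :
    IsAlgebraicMatroid.{u, v, w} ((AlgebraicIndependent.matroid F K).comapOn E e) := by
  refine ⟨F, inferInstance, K, inferInstance, inferInstance, e, fun S hS ↦ ?_⟩
  rw [Matroid.eRk_comapOn _ _ (E := E) hS, matroid_eRk_eq_toENat_trdeg]

theorem mainTheorem12 {α : Type w} (M : Matroid α) [M.Finite]
    (hM : IsAlgebraicMatroid.{u, v, w} M)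
    (X Y Z A : Set α) (hX : M.IsFlat X) (hY : M.IsFlat Y) (hZ : M.IsFlat Z)
    (hA : A = X ∩ Y ∩ Z)
    (hXZ : FlatCovers M X (X ∩ Z)) (hYZ : FlatCovers M Y (Y ∩ Z))
    (hr : M.eRk A + 1 < M.eRk (X ∩ Y)) :
    ∃ M' : Matroid (Option α),
      IsPointExtension M' M ∧
      IsAlgebraicMatroid.{u, v, w} M' ∧
      none ∈ M'.closure (some '' X) ∧
      none ∈ M'.closure (some '' Y) ∧
      none ∈ M'.closure (some '' Z) ∧
      M'.eRk (some '' A) < M'.eRk (insert none (some '' A)) := by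
  obtain ⟨F, _, K, _, _, _, e, he⟩ := hM.exists_isAlgClosed
  let N := AlgebraicIndependent.matroid F K
  have hXE := hX.subset_ground
  have hYE := hY.subset_ground
  have hZE := hZ.subset_ground
  have hAX : A ⊆ X ∩ Y := hA ▸ Set.inter_subset_left
  have hAE : A ⊆ M.E := hAX.trans (Set.inter_subset_left.trans hXE)
  have hmem {S : Set α} {q : α} (hS : S ⊆ M.E) (hq : q ∈ M.E) :
      q ∈ M.closure S ↔ e q ∈ closureField F (e '' S) := by
    rw [Matroid.mem_closure_iff_of_eRk_eq e he hS (M.ground_finite.subset hS) hq (Set.mem_univ _),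
      mem_matroid_closure_iff_mem_closureField]
  -- The rank hypothesis gives two elements `u`, `v` of `X ∩ Y` that are independent over `A`.
  obtain ⟨u, ⟨⟨huX, huY⟩, huA⟩, hu⟩ := Matroid.exists_eRk_insert_eq_add_one_of_lt
    ((le_self_add (a := M.eRk A)).trans_lt hr)
  obtain ⟨v, ⟨⟨hvX, hvY⟩, -⟩, hv⟩ := Matroid.exists_eRk_insert_eq_add_one_of_lt (hu ▸ hr)
  have huZ : u ∉ Z := fun h ↦ huA (hA ▸ ⟨⟨huX, huY⟩, h⟩)
  have hvA : v ∉ M.closure (insert u A) := fun h ↦ by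
    have hfin := M.isRkFinite_set (insert u A)
    rw [(Matroid.mem_closure_iff_eRk_insert_eq (hXE hvX) hfin).1 h] at hv
    exact ((ENat.lt_add_one_iff hfin.eRk_lt_top.ne).2 le_rfl).ne hv
  rw [hmem (Set.insert_subset (hXE huX) hAE) (hXE hvX), Set.image_insert_eq] at hvA
  have hvX' : v ∈ M.closure (insert u (X ∩ Z)) := by
    rwa [hXZ.closure_insert_eq huX fun h ↦ huZ h.2]
  have hvY' : v ∈ M.closure (insert u (Y ∩ Z)) := by
    rwa [hYZ.closure_insert_eq huY fun h ↦ huZ h.2]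
  rw [hmem (Set.insert_subset (hXE huX) (Set.inter_subset_left.trans hXE)) (hXE hvX),
    Set.image_insert_eq] at hvX'
  rw [hmem (Set.insert_subset (hXE huX) (Set.inter_subset_left.trans hYE)) (hXE hvX),
    Set.image_insert_eq] at hvY'
  rw [← hZ.closure, hmem hZE (hXE huX)] at huZ
  obtain ⟨c, hcX, hcY, hcA⟩ := exists_mem_closureField_inter (Set.image_mono Set.inter_subset_right)
    (Set.image_mono Set.inter_subset_right) huZ hvX' hvY' hvA
  -- The new point is represented by `c`.
  let e' : Option α → K := fun o ↦ o.elim c e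
  let E' : Set (Option α) := insert none (some '' M.E)
  have himg (S : Set α) : e' '' (some '' S) = e '' S := by rw [Set.image_image]; rfl
  have hE' {S : Set α} (hS : S ⊆ M.E) : some '' S ⊆ E' :=
    (Set.image_mono hS).trans (Set.subset_insert _ _)
  have hrk (T : Set (Option α)) (hT : T ⊆ E') : (N.comapOn E' e').eRk T = N.eRk (e' '' T) :=
    N.eRk_comapOn e' hT
  have hnone {S : Set α} (hS : S ⊆ M.E) :
      none ∈ (N.comapOn E' e').closure (some '' S) ↔ c ∈ closureField F (e '' S) := by
    rw [Matroid.mem_closure_iff_of_eRk_eq e' hrk (hE' hS) ((M.ground_finite.subset hS).image _)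
      (Set.mem_insert _ _) (Set.mem_univ _), mem_matroid_closure_iff_mem_closureField, himg]
    rfl
  have hc {S T : Set α} (hST : S ⊆ T) (h : c ∈ closureField F (e '' S)) :
      c ∈ closureField F (e '' T) :=
    closureField_mono ((Set.image_mono hST).trans (subset_closureField _)) h
  refine ⟨N.comapOn E' e', ⟨rfl, fun S hS ↦ ?_⟩, isAlgebraicMatroid_comapOn E' e',
    (hnone hXE).2 (hc Set.inter_subset_left hcX), (hnone hYE).2 (hc Set.inter_subset_left hcY),
    (hnone hZE).2 (hc Set.inter_subset_right hcX), ?_⟩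
  · rw [hrk _ (hE' hS), himg, he S hS]
  · have hfin := (N.comapOn E' e').isRkFinite_of_finite ((M.ground_finite.subset hAE).image some)
    rw [Matroid.eRk_insert_eq_add_one ⟨Set.mem_insert _ _, fun h ↦ hcA ((hnone hAE).1 h)⟩]
    exact (ENat.lt_add_one_iff hfin.eRk_lt_top.ne).2 le_rfl
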